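/- Let $X$ be a finite connected simplicial complex whose fundamental group is amenable, i.e. there is a positive linear functional $\mu\colon L^\infty(\pi_1(X))\to\mathbb R$ on the bounded functions with $\mu(1)=1$ that is invariant under left translations. Let $p\colon\widetilde X\to X$ be the universal cover with the lifted simplicial structure. A (smooth) differential form on a simplicial complex is a collection of smooth forms on the closed simplices that is compatible with restriction to faces; the exterior derivative is taken on each simplex. A Riemannian metric on a simplicial complex is a collection of smooth Riemannian metrics on the closed simplices that is compatible with restriction to faces. A $k$-form is bounded with respect to a metric if its values on orthonormal $k$-tuples of tangent vectors are bounded, uniformly over all points of all simplices. A closed $k$-form $\eta$ on $X$ is a de Rham representative of $\alpha\in H^k(X;\mathbb R)$ if the simplicial cocycle $\sigma\mapsto\int_\sigma\eta$ represents $\alpha$. Let $g$ be a Riemannian metric on $X$ and let $\widetilde g=p^*g$. For $k\ge 0$, a class $\alpha\in H^k(X;\mathbb R)$ is called hyperbolic if it has a de Rham representative $\eta$ such that $p^*\eta=d\beta$ for some $(k-1)$-form $\beta$ on $\widetilde X$ that is bounded with respect to $\widetilde g$ (for $k=0$, where there are no nonzero $(k-1)$-forms, this means $p^*\eta=0$).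 Then, for every $k\ge 0$ and every such $g$, every hyperbolic class $\alpha\in H^k(X;\mathbb R)$ is zero. -/

import Mathlib

open scoped ContDiff

noncomputable section

/-! ### Amenable groups -/

/-- The real vector space `L^∞(G)` of bounded functions on a (discrete) group. -/
def boundedFunctions (G : Type*) : Submodule ℝ (G → ℝ) where
  carrier := {f | ∃ C : ℝ, ∀ x, |f x| ≤ C}
  zero_mem' := ⟨0, fun x => by simp⟩
  add_mem' := by
    rintro f g ⟨C, hC⟩ ⟨D, hD⟩
    exact ⟨C + D, fun x => (abs_add_le _ _).trans (add_le_add (hC x) (hD x))⟩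
  smul_mem' := by
    rintro c f ⟨C, hC⟩
    refine ⟨|c| * C, fun x => ?_⟩
    simpa [abs_mul] using mul_le_mul_of_nonneg_left (hC x) (abs_nonneg c)

/-- Left translation of a bounded function: `(g · f)(x) = f (g⁻¹ x)`. -/
def leftTranslate {G : Type*} [Group G] (g : G) (f : boundedFunctions G) : boundedFunctions G :=
  ⟨fun x => f.1 (g⁻¹ * x), f.2.imp fun _ h x => h (g⁻¹ * x)⟩

/-- The constant function `1`, as a bounded function. -/
def boundedOne (G : Type*) : boundedFunctions G :=
  ⟨fun _ => 1, 1, fun _ => by simp⟩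

/-- A group is amenable if it admits a left-invariant mean. -/
def IsAmenable (G : Type*) [Group G] : Prop :=
  ∃ m : boundedFunctions G →ₗ[ℝ] ℝ,
    m (boundedOne G) = 1 ∧
    (∀ f : boundedFunctions G, (∀ x, 0 ≤ f.1 x) → 0 ≤ m f) ∧
    ∀ (g : G) (f : boundedFunctions G), m (leftTranslate g f) = m f

/-! ### Model simplices

The standard `n`-simplex is taken in the coordinates `x₁, …, xₙ` (the barycentric coordinates
other than the zeroth one), so that it has non-empty interior in `ℝⁿ`. -/

/-- The `n`-simplex `{x ∈ ℝⁿ | 0 ≤ xᵢ, ∑ xᵢ ≤ 1}`. -/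
def modelSimplex (n : ℕ) : Set (Fin n → ℝ) :=
  {x | (∀ i, 0 ≤ x i) ∧ ∑ i, x i ≤ 1}

/-- The vertices of the model simplex: the origin, followed by the standard basis vectors. -/
def modelVertex (n : ℕ) : Fin (n + 1) → (Fin n → ℝ) :=
  Fin.cons 0 fun i => Pi.single i 1

/-- The linear part of the affine map `modelMap f`. -/
def modelMapLinear {m n : ℕ} (f : Fin (m + 1) → Fin (n + 1)) : (Fin m → ℝ) →L[ℝ] (Fin n → ℝ) :=
  ∑ i : Fin m, (ContinuousLinearMap.proj (R := ℝ) (φ := fun _ : Fin m => ℝ) i).smulRight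
    (modelVertex n (f i.succ) - modelVertex n (f 0))

/-- The affine map between model simplices that sends the `i`-th vertex to the `f i`-th one. -/
def modelMap {m n : ℕ} (f : Fin (m + 1) → Fin (n + 1)) (x : Fin m → ℝ) : Fin n → ℝ :=
  modelVertex n (f 0) + modelMapLinear f x

namespace AbstractSimplicialComplex

/-! ### Ordered simplices and simplicial cohomology -/

/-- An `n`-simplex of `K` together with an ordering of its `n + 1` vertices. -/
structure OrderedSimplex {V : Type*} (K : AbstractSimplicialComplex V) (n : ℕ) where
  vert : Fin (n + 1) ↪ V
  mem : Finset.univ.map vert ∈ K.faces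

/-- The face (or the reordering) of an ordered simplex given by an injective map of vertices. -/
def OrderedSimplex.face {V : Type*} {K : AbstractSimplicialComplex V} {m n : ℕ}
    (e : K.OrderedSimplex n) (f : Fin (m + 1) ↪ Fin (n + 1)) : K.OrderedSimplex m where
  vert := f.trans e.vert
  mem := by
    refine (K.isRelLowerSet_faces e.mem).2 (fun v hv => ?_) ⟨e.vert (f 0), by simp⟩
    simp only [Finset.mem_map, Finset.mem_univ, true_and] at hv ⊢
    obtain ⟨i, rfl⟩ := hv
    exact ⟨f i, rfl⟩

/-- Real simplicial `k`-cochains: functions on ordered `k`-simplices that change by the sign of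
the permutation when the vertices are reordered. -/
def cochains {V : Type*} (K : AbstractSimplicialComplex V) (k : ℕ) :
    Submodule ℝ (K.OrderedSimplex k → ℝ) where
  carrier := {c | ∀ (e : K.OrderedSimplex k) (s : Equiv.Perm (Fin (k + 1))),
    c (e.face s.toEmbedding) = ((Equiv.Perm.sign s : ℤ) : ℝ) * c e}
  zero_mem' := fun _ _ => by simp
  add_mem' := fun {a b} ha hb e s => by simp [ha e s, hb e s, mul_add]
  smul_mem' := fun r a ha e s => by simp [ha e s, mul_left_comm]

/-- The simplicial coboundary `(δ c)(v₀, …, vₖ₊₁) = ∑ᵢ (-1)ⁱ c(v₀, …, v̂ᵢ, …, vₖ₊₁)`. -/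
def coboundary {V : Type*} (K : AbstractSimplicialComplex V) (k : ℕ) :
    (K.OrderedSimplex k → ℝ) →ₗ[ℝ] (K.OrderedSimplex (k + 1) → ℝ) where
  toFun c e := ∑ i : Fin (k + 2), (-1 : ℝ) ^ (i : ℕ) * c (e.face (Fin.succAboveEmb i))
  map_add' a b := by
    funext e
    simp [mul_add, Finset.sum_add_distrib]
  map_smul' r a := by
    funext e
    simp [Finset.mul_sum, mul_left_comm]

/-- Simplicial `k`-cocycles. -/
def cocycles {V : Type*} (K : AbstractSimplicialComplex V) (k : ℕ) :
    Submodule ℝ (K.OrderedSimplex k → ℝ) :=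
  K.cochains k ⊓ LinearMap.ker (K.coboundary k)

/-- Simplicial `k`-coboundaries; there are no non-zero ones in degree `0`. -/
def coboundaries {V : Type*} (K : AbstractSimplicialComplex V) :
    (k : ℕ) → Submodule ℝ (K.OrderedSimplex k → ℝ)
  | 0 => ⊥
  | k + 1 => (K.cochains k).map (K.coboundary k)

/-- The simplicial cohomology `H^k(K; ℝ)`: cocycles modulo coboundaries. -/
abbrev Cohomology {V : Type*} (K : AbstractSimplicialComplex V) (k : ℕ) : Type _ :=
  K.cocycles k ⧸ (K.coboundaries k).submoduleOf (K.cocycles k)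

/-- The cohomology class of a cocycle. -/
def cohomologyClass {V : Type*} (K : AbstractSimplicialComplex V) (k : ℕ) (a : K.cocycles k) :
    K.Cohomology k :=
  Submodule.Quotient.mk a

/-! ### Differential forms and metrics on a simplicial complex -/

/-- A smooth differential `k`-form on a simplicial complex: a smooth form on every closed simplex
(read in the coordinates given by any ordering of the vertices), compatible with restriction to
faces and with reordering of the vertices. Only the values on the closed model simplices matter. -/
structure DiffForm {V : Type*} (K : AbstractSimplicialComplex V) (k : ℕ) where
  form : ∀ {n : ℕ}, K.OrderedSimplex n → (Fin n → ℝ) → (Fin n → ℝ) [⋀^Fin k]→L[ℝ] ℝ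
  smooth : ∀ {n : ℕ} (e : K.OrderedSimplex n), ContDiffOn ℝ ∞ (form e) (modelSimplex n)
  compatible : ∀ {m n : ℕ} (e : K.OrderedSimplex n) (f : Fin (m + 1) ↪ Fin (n + 1)),
    ∀ x ∈ modelSimplex m,
      form (e.face f) x = (form e (modelMap f x)).compContinuousLinearMap (modelMapLinear f)

/-- A Riemannian metric on a simplicial complex: a smooth Riemannian metric on every closed
simplex, compatible with restriction to faces and with reordering of the vertices. -/
structure Metric {V : Type*} (K : AbstractSimplicialComplex V) where
  inner : ∀ {n : ℕ}, K.OrderedSimplex n →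
    (Fin n → ℝ) → (Fin n → ℝ) →L[ℝ] (Fin n → ℝ) →L[ℝ] ℝ
  smooth : ∀ {n : ℕ} (e : K.OrderedSimplex n), ContDiffOn ℝ ∞ (inner e) (modelSimplex n)
  symm : ∀ {n : ℕ} (e : K.OrderedSimplex n), ∀ x ∈ modelSimplex n,
    ∀ v w, inner e x v w = inner e x w v
  pos : ∀ {n : ℕ} (e : K.OrderedSimplex n), ∀ x ∈ modelSimplex n,
    ∀ v, v ≠ 0 → 0 < inner e x v v
  compatible : ∀ {m n : ℕ} (e : K.OrderedSimplex n) (f : Fin (m + 1) ↪ Fin (n + 1)),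
    ∀ x ∈ modelSimplex m, ∀ v w,
      inner (e.face f) x v w = inner e (modelMap f x) (modelMapLinear f v) (modelMapLinear f w)

namespace DiffForm

/-- The exterior derivative of `β` on every simplex is `η`. -/
def IsPrimitive {V : Type*} {K : AbstractSimplicialComplex V} {k : ℕ}
    (β : K.DiffForm k) (η : K.DiffForm (k + 1)) : Prop :=
  ∀ {n : ℕ} (e : K.OrderedSimplex n), ∀ x ∈ modelSimplex n,
    extDerivWithin (β.form e) (modelSimplex n) x = η.form e x

/-- The exterior derivative of `η` vanishes on every simplex. -/
def IsClosedForm {V : Type*} {K : AbstractSimplicialComplex V} {k : ℕ} (η : K.DiffForm k) : Prop :=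
  ∀ {n : ℕ} (e : K.OrderedSimplex n), ∀ x ∈ modelSimplex n,
    extDerivWithin (η.form e) (modelSimplex n) x = 0

/-- A form is bounded with respect to a metric if its values on orthonormal tuples of tangent
vectors are bounded uniformly over all points of all simplices. -/
def IsBounded {V : Type*} {K : AbstractSimplicialComplex V} {k : ℕ} (g : K.Metric)
    (η : K.DiffForm k) : Prop :=
  ∃ C : ℝ, ∀ {n : ℕ} (e : K.OrderedSimplex n), ∀ x ∈ modelSimplex n,
    ∀ v : Fin k → (Fin n → ℝ), (∀ i j, g.inner e x (v i) (v j) = if i = j then 1 else 0) →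
      |η.form e x v| ≤ C

/-- `η` is the exterior derivative of a bounded form. There are no non-zero forms of degree `-1`,
so in degree `0` this means `η = 0`. -/
def HasBoundedPrimitive {V : Type*} {K : AbstractSimplicialComplex V} (g : K.Metric) :
    {k : ℕ} → K.DiffForm k → Prop
  | 0, η => ∀ {n : ℕ} (e : K.OrderedSimplex n), ∀ x ∈ modelSimplex n, η.form e x = 0
  | k + 1, η => ∃ β : K.DiffForm k, β.IsPrimitive η ∧ β.IsBounded g

/-- The integral of a `k`-form over an ordered `k`-simplex, oriented by the ordering. -/
def integral {V : Type*} {K : AbstractSimplicialComplex V} {k : ℕ} (η : K.DiffForm k)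
    (e : K.OrderedSimplex k) : ℝ :=
  ∫ x in modelSimplex k, η.form e x fun i => Pi.single i 1

/-- `η` is a de Rham representative of the class `α`: it is closed, and integration of `η` over
simplices is a cocycle in the class `α`. -/
def Represents {V : Type*} {K : AbstractSimplicialComplex V} {k : ℕ} (η : K.DiffForm k)
    (α : K.Cohomology k) : Prop :=
  η.IsClosedForm ∧ ∃ a : K.cocycles k, a.1 = η.integral ∧ K.cohomologyClass k a = α

end DiffForm

/-! ### Geometric realization -/

/-- The geometric realization of a finite simplicial complex, in barycentric coordinates, with
the subspace topology from `ℝ^V`. -/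
abbrev Realization {V : Type*} [Fintype V] (K : AbstractSimplicialComplex V) : Type _ :=
  {x : V → ℝ // (∀ v, 0 ≤ x v) ∧ ∑ v, x v = 1 ∧ ∃ s ∈ K.faces, ∀ v, v ∉ s → x v = 0}

/-- The point of the realization given by a vertex. -/
def vertexPoint {V : Type*} [Fintype V] [DecidableEq V] (K : AbstractSimplicialComplex V) (v : V) :
    K.Realization :=
  ⟨Pi.single v 1, fun w => by
      by_cases h : w = v
      · subst h; simp
      · simp [h],
    by simp, {v}, K.singleton_mem v, fun w hw => by
      simp only [Finset.mem_singleton] at hw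
      simp [hw]⟩

/-- The straight path from `v` to `w` along an edge (constant if `v = w`). -/
def edgePath {V : Type*} [Fintype V] [DecidableEq V] (K : AbstractSimplicialComplex V) {v w : V}
    (h : {v, w} ∈ K.faces) : Path (K.vertexPoint v) (K.vertexPoint w) where
  toFun t := ⟨fun u => (1 - (t : ℝ)) * (K.vertexPoint v).1 u + (t : ℝ) * (K.vertexPoint w).1 u,
    fun u => add_nonneg
      (mul_nonneg (sub_nonneg.2 t.2.2) ((K.vertexPoint v).2.1 u))
      (mul_nonneg t.2.1 ((K.vertexPoint w).2.1 u)),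
    by
      rw [Finset.sum_add_distrib, ← Finset.mul_sum, ← Finset.mul_sum, (K.vertexPoint v).2.2.1,
        (K.vertexPoint w).2.2.1]
      ring,
    {v, w}, h, fun u hu => by
      simp only [Finset.mem_insert, Finset.mem_singleton, not_or] at hu
      simp [vertexPoint, hu.1, hu.2]⟩
  continuous_toFun := by
    refine Continuous.subtype_mk (continuous_pi fun u => ?_) _
    fun_prop
  source' := by ext u; simp
  target' := by ext u; simp

/-! ### The universal cover -/

/-- The vertices of the universal cover with respect to a base point `x₀`: the points of the
universal cover (homotopy classes of paths in the realization that start at `x₀`) that lie over a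
vertex. -/
structure CoverVertex {V : Type*} [Fintype V] [DecidableEq V] (K : AbstractSimplicialComplex V)
    (x₀ : K.Realization) where
  base : V
  path : Path.Homotopic.Quotient x₀ (K.vertexPoint base)

/-- The universal cover of a connected finite simplicial complex, with the lifted simplicial
structure: a finite set of vertices spans a simplex if it lies bijectively over a simplex of `K`
and is the vertex set of a lift of that simplex, i.e. any two of its vertices are joined by the
lift of the edge between their projections. -/
def universalCover {V : Type*} [Fintype V] [DecidableEq V] (K : AbstractSimplicialComplex V)
    (x₀ : K.Realization) : AbstractSimplicialComplex (K.CoverVertex x₀) where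
  faces := {t | Set.InjOn CoverVertex.base (t : Set (K.CoverVertex x₀)) ∧
    t.image CoverVertex.base ∈ K.faces ∧
    ∀ a ∈ t, ∀ b ∈ t, ∃ h : {a.base, b.base} ∈ K.faces,
      b.path = a.path.trans (Path.Homotopic.Quotient.mk (K.edgePath h))}
  isRelLowerSet_faces := by
    rintro t ⟨hinj, hmem, hedge⟩
    refine ⟨Finset.image_nonempty.1 (K.isRelLowerSet_faces hmem).1, fun s hst hs => ?_⟩
    exact ⟨hinj.mono (by exact_mod_cast hst),
      (K.isRelLowerSet_faces hmem).2 (Finset.image_subset_image hst) (hs.image _),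
      fun a ha b hb => hedge a (hst ha) b (hst hb)⟩
  singleton_mem := by
    intro a
    have h : {a.base, a.base} ∈ K.faces := by simpa using K.singleton_mem a.base
    have hrefl : K.edgePath h = Path.refl _ := by
      ext t u
      change (1 - (t : ℝ)) * (K.vertexPoint a.base).1 u + (t : ℝ) * (K.vertexPoint a.base).1 u = _
      simp only [Path.refl_apply]
      ring
    refine ⟨by simp, by simpa using K.singleton_mem a.base, fun b hb c hc => ?_⟩
    obtain rfl := Finset.mem_singleton.1 hb
    obtain rfl := Finset.mem_singleton.1 hc
    refine ⟨h, ?_⟩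
    rw [hrefl]
    simp

/-- The image of an ordered simplex under the covering projection. -/
def OrderedSimplex.proj {V : Type*} [Fintype V] [DecidableEq V] {K : AbstractSimplicialComplex V}
    {x₀ : K.Realization} {n : ℕ} (e : (K.universalCover x₀).OrderedSimplex n) :
    K.OrderedSimplex n where
  vert := ⟨fun i => (e.vert i).base, fun i j hij =>
    e.vert.injective (e.mem.1 (by simp) (by simp) hij)⟩
  mem := by
    have h := e.mem.2.1
    convert h using 1
    ext v
    simp only [Finset.mem_map, Finset.mem_univ, true_and, Finset.mem_image, exists_exists_eq_and]
    rfl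

/-- The pull-back `p^* η` of a form to the universal cover. -/
def DiffForm.pullback {V : Type*} [Fintype V] [DecidableEq V] {K : AbstractSimplicialComplex V}
    {k : ℕ} (η : K.DiffForm k) (x₀ : K.Realization) : (K.universalCover x₀).DiffForm k where
  form e := η.form e.proj
  smooth e := η.smooth e.proj
  compatible e f := η.compatible e.proj f

/-- The pull-back of a metric to the universal cover. -/
def Metric.pullback {V : Type*} [Fintype V] [DecidableEq V] {K : AbstractSimplicialComplex V}
    (g : K.Metric) (x₀ : K.Realization) : (K.universalCover x₀).Metric where
  inner e := g.inner e.proj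
  smooth e := g.smooth e.proj
  symm e := g.symm e.proj
  pos e := g.pos e.proj
  compatible e f := g.compatible e.proj f

/-- A class is hyperbolic if it has a de Rham representative whose pull-back to the universal cover
has a primitive that is bounded with respect to the pulled back metric. -/
def IsHyperbolic {V : Type*} [Fintype V] [DecidableEq V] {K : AbstractSimplicialComplex V}
    (x₀ : K.Realization) (g : K.Metric) {k : ℕ} (α : K.Cohomology k) : Prop :=
  ∃ η : K.DiffForm k, η.Represents α ∧ (η.pullback x₀).HasBoundedPrimitive (g.pullback x₀)

end AbstractSimplicialComplex

end

noncomputable section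

/-! ### Geometry of the model simplices -/

/-! Integration turns the bounded primitive into a bounded simplicial cochain on the universal
cover, and amenability averages that cochain down to the base. Let `p^*η = dβ` with `β` bounded.
Stokes' theorem (`stokes_modelSimplex`, `DiffForm.coboundary_integral`) says that the cochain `b =
∫β` satisfies `δb = p^*a`, where `a = ∫η`. The metric upstairs is pulled back from finitely many
compact simplices, so their volumes are uniformly bounded and `b` is bounded
(`abs_alternating_single_le`, `DiffForm.IsBounded.integral_bounded`).

The lifts of an ordered simplex of `K` correspond to the path classes from `x₀` to its zeroth
vertex. An invariant mean on the fundamental group yields means on all these sets of path classes,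
compatible with prolonging paths (`exists_pathMean`). Let `c` send a simplex to the mean of `b` over
its lifts. Compatibility lets the faces of a simplex be averaged over the lifts of that simplex, so
`δc` is the mean of `δb`. There `δb` is constantly `a`, and the mean of a constant is that constant:
`δc = a` (`mem_coboundaries_of_bounded_primitive`). In degree `0` the form itself vanishes, because
every vertex lifts. -/

lemma modelVertex_zero (n : ℕ) : modelVertex n 0 = 0 := rfl

lemma modelVertex_succ (n : ℕ) (i : Fin n) : modelVertex n i.succ = Pi.single i 1 := rfl

lemma modelMapLinear_apply {m n : ℕ} (f : Fin (m + 1) → Fin (n + 1)) (x : Fin m → ℝ) :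
    modelMapLinear f x = ∑ i, x i • (modelVertex n (f i.succ) - modelVertex n (f 0)) := by
  simp [modelMapLinear]

lemma modelMapLinear_single {m n : ℕ} (f : Fin (m + 1) → Fin (n + 1)) (i : Fin m) :
    modelMapLinear f (Pi.single i 1) = modelVertex n (f i.succ) - modelVertex n (f 0) := by
  rw [modelMapLinear_apply, Finset.sum_eq_single i] <;> simp +contextual

lemma modelMap_modelVertex {m n : ℕ} (f : Fin (m + 1) → Fin (n + 1)) (i : Fin (m + 1)) :
    modelMap f (modelVertex m i) = modelVertex n (f i) := by
  refine Fin.cases ?_ (fun i => ?_) i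
  · simp [modelMap, modelVertex_zero]
  · simp [modelMap, modelVertex_succ, modelMapLinear_single]

lemma modelMapLinear_modelMapLinear {m n p : ℕ} (f : Fin (m + 1) → Fin (n + 1))
    (h : Fin (n + 1) → Fin (p + 1)) (x : Fin m → ℝ) :
    modelMapLinear h (modelMapLinear f x) = modelMapLinear (h ∘ f) x := by
  rw [modelMapLinear_apply f, modelMapLinear_apply (h ∘ f), map_sum]
  refine Finset.sum_congr rfl fun i _ => ?_
  rw [map_smul, map_sub]
  congr 1
  have h1 := modelMap_modelVertex h (f i.succ)
  have h2 := modelMap_modelVertex h (f 0)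
  rw [Function.comp_apply, Function.comp_apply, ← h1, ← h2, modelMap, modelMap]
  abel

lemma modelMap_modelMap {m n p : ℕ} (f : Fin (m + 1) → Fin (n + 1))
    (h : Fin (n + 1) → Fin (p + 1)) (x : Fin m → ℝ) :
    modelMap h (modelMap f x) = modelMap (h ∘ f) x := by
  have h2 := modelMap_modelVertex h (f 0)
  rw [modelMap] at h2
  rw [modelMap, modelMap, map_add, ← add_assoc, h2, modelMapLinear_modelMapLinear, modelMap]
  rfl

lemma modelMap_id {n : ℕ} (x : Fin n → ℝ) : modelMap id x = x := by
  rw [modelMap, modelMapLinear_apply]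
  ext j
  simp [modelVertex_zero, modelVertex_succ, Pi.single_apply]

lemma modelVertex_mem (n : ℕ) (i : Fin (n + 1)) : modelVertex n i ∈ modelSimplex n := by
  refine Fin.cases ?_ (fun i => ?_) i
  · simp [modelSimplex, modelVertex_zero]
  · refine ⟨fun j => ?_, ?_⟩
    · rw [modelVertex_succ, Pi.single_apply]
      split_ifs <;> norm_num
    · simp [modelVertex_succ]

lemma convex_modelSimplex (n : ℕ) : Convex ℝ (modelSimplex n) := by
  rintro x ⟨hx, hx'⟩ y ⟨hy, hy'⟩ a b ha hb hab
  refine ⟨fun i => ?_, ?_⟩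
  · have := hx i
    have := hy i
    simp only [Pi.add_apply, Pi.smul_apply, smul_eq_mul]
    positivity
  · simp only [Pi.add_apply, Pi.smul_apply, smul_eq_mul, Finset.sum_add_distrib, ← Finset.mul_sum]
    nlinarith

lemma modelMap_mem {m n : ℕ} (f : Fin (m + 1) → Fin (n + 1)) {x : Fin m → ℝ}
    (hx : x ∈ modelSimplex m) : modelMap f x ∈ modelSimplex n := by
  -- The image is the convex combination of the vertices `f i` whose weights are the barycentric
  -- coordinates of `x`, the zeroth being `1 - ∑ xᵢ`.
  have key : modelMap f x = ∑ i : Fin (m + 1),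
      (Fin.cons (1 - ∑ i, x i) x : Fin (m + 1) → ℝ) i • modelVertex n (f i) := by
    rw [Fin.sum_univ_succ, modelMap, modelMapLinear_apply]
    simp [smul_sub, sub_smul, Finset.sum_sub_distrib, ← Finset.sum_smul]
    abel
  rw [key]
  refine (convex_modelSimplex n).sum_mem (fun i _ => ?_) ?_ fun i _ => modelVertex_mem n _
  · refine Fin.cases ?_ (fun i => ?_) i
    · simpa using hx.2
    · simpa using hx.1 i
  · simp [Fin.sum_univ_succ]

lemma continuous_modelMap {m n : ℕ} (f : Fin (m + 1) → Fin (n + 1)) :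
    Continuous (modelMap f) :=
  continuous_const.add (modelMapLinear f).continuous

lemma isClosed_modelSimplex (n : ℕ) : IsClosed (modelSimplex n) := by
  have : modelSimplex n = (⋂ i, {x : Fin n → ℝ | 0 ≤ x i}) ∩ {x | ∑ i, x i ≤ 1} := by
    ext x
    simp [modelSimplex]
  rw [this]
  refine (isClosed_iInter fun i => isClosed_le continuous_const (continuous_apply i)).inter
    (isClosed_le (by fun_prop) continuous_const)

lemma isCompact_modelSimplex (n : ℕ) : IsCompact (modelSimplex n) := by
  refine (isCompact_Icc (a := (0 : Fin n → ℝ)) (b := 1)).of_isClosed_subset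
    (isClosed_modelSimplex n) ?_
  rintro x ⟨h0, h1⟩
  exact ⟨h0, fun i => (Finset.single_le_sum (fun j _ => h0 j) (Finset.mem_univ i)).trans h1⟩

lemma measurableSet_modelSimplex (n : ℕ) : MeasurableSet (modelSimplex n) :=
  (isClosed_modelSimplex n).measurableSet

lemma mem_interior_modelSimplex {n : ℕ} {x : Fin n → ℝ} (h0 : ∀ i, 0 < x i) (h1 : ∑ i, x i < 1) :
    x ∈ interior (modelSimplex n) := by
  rw [mem_interior]
  refine ⟨(⋂ i, {x : Fin n → ℝ | 0 < x i}) ∩ {x | ∑ i, x i < 1}, ?_, ?_, ?_⟩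
  · rintro y ⟨hy, hy'⟩
    exact ⟨fun i => (Set.mem_iInter.1 hy i).le, le_of_lt hy'⟩
  · exact (isOpen_iInter_of_finite fun i => isOpen_lt continuous_const (continuous_apply i)).inter
      (isOpen_lt (by fun_prop) continuous_const)
  · exact ⟨Set.mem_iInter.2 h0, h1⟩

lemma uniqueDiffOn_modelSimplex (n : ℕ) : UniqueDiffOn ℝ (modelSimplex n) := by
  refine uniqueDiffOn_convex (convex_modelSimplex n)
    ⟨fun _ => 1 / ((n : ℝ) + 1), mem_interior_modelSimplex (fun i => by positivity) ?_⟩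
  simp only [Finset.sum_const, Finset.card_univ, Fintype.card_fin, nsmul_eq_mul]
  rw [mul_one_div, div_lt_one (by positivity)]
  linarith

/-! ### Reordering the vertices of the model simplex -/

/-- Subtracting row `0` from the other rows clears the column of ones below its first entry;
expanding along that column leaves the edge vectors. The bordered matrix treats all vertices alike,
so a permutation of the vertices merely permutes its rows. -/
lemma det_sub_zero_row {k : ℕ} (w : Fin (k + 1) → Fin k → ℝ) :
    (Matrix.of fun i : Fin k => w i.succ - w 0).det =
      (Matrix.of fun i : Fin (k + 1) => (Fin.cons 1 (w i) : Fin (k + 1) → ℝ)).det := by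
  have h : (Matrix.of fun i : Fin (k + 1) => (Fin.cons 1 (w i) : Fin (k + 1) → ℝ)).det =
      (Matrix.of fun i : Fin (k + 1) => (Fin.cons (if i = 0 then 1 else 0)
        (if i = 0 then w 0 else w i - w 0) : Fin (k + 1) → ℝ)).det := by
    refine Matrix.det_eq_of_forall_row_eq_smul_add_const (fun i => if i = 0 then 0 else 1) 0
      (by simp) fun i j => ?_
    refine Fin.cases ?_ (fun i => ?_) i <;> refine Fin.cases ?_ (fun j => ?_) j <;>
      simp [Fin.succ_ne_zero]
  rw [h, Matrix.det_succ_column_zero, Fin.sum_univ_succ]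
  simp only [Matrix.of_apply, Fin.cons_zero, Fin.succ_ne_zero, if_true, if_false]
  simp only [Fin.val_zero, pow_zero, one_mul, Fin.succAbove_zero, mul_zero, zero_mul,
    Finset.sum_const_zero, add_zero]
  rfl

lemma det_modelMapLinear {k : ℕ} (s : Equiv.Perm (Fin (k + 1))) :
    (modelMapLinear s).det = ((Equiv.Perm.sign s : ℤ) : ℝ) := by
  have key : ∀ s : Equiv.Perm (Fin (k + 1)), (modelMapLinear s).det =
      (Matrix.of fun i : Fin (k + 1) =>
        (Fin.cons 1 (modelVertex k (s i)) : Fin (k + 1) → ℝ)).det := by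
    intro s
    rw [← det_sub_zero_row fun i => modelVertex k (s i), ContinuousLinearMap.det,
      ← LinearMap.det_toMatrix', ← Matrix.det_transpose]
    congr 1
    ext i j
    rw [Matrix.transpose_apply, LinearMap.toMatrix'_apply, Matrix.of_apply]
    exact congrFun (modelMapLinear_single s i) j
  have h1 := key 1
  have h2 : (modelMapLinear (1 : Equiv.Perm (Fin (k + 1)))).det = 1 := by
    have : modelMapLinear (1 : Equiv.Perm (Fin (k + 1))) = ContinuousLinearMap.id ℝ _ := by
      ext x j
      have := congrFun (modelMap_id x) j
      rwa [modelMap, id, modelVertex_zero, zero_add] at this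
    rw [this]
    exact LinearMap.det_id
  rw [h2] at h1
  rw [key s]
  have := Matrix.det_permute s (Matrix.of fun i : Fin (k + 1) =>
        (Fin.cons 1 (modelVertex k i) : Fin (k + 1) → ℝ))
  rw [show (Matrix.of fun i : Fin (k + 1) =>
        (Fin.cons 1 (modelVertex k i) : Fin (k + 1) → ℝ)).det = 1 from h1.symm, mul_one] at this
  exact this

lemma image_modelMap_perm {k : ℕ} (s : Equiv.Perm (Fin (k + 1))) :
    modelMap s '' modelSimplex k = modelSimplex k := by
  refine Set.Subset.antisymm ?_ fun x hx => ⟨modelMap s.symm x, modelMap_mem _ hx, ?_⟩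
  · rintro _ ⟨x, hx, rfl⟩
    exact modelMap_mem _ hx
  · rw [modelMap_modelMap, Equiv.self_comp_symm, modelMap_id]

/-- Change of variables: reordering the vertices is an affine bijection of the simplex with
determinant `±1`. -/
lemma setIntegral_comp_modelMap_perm {k : ℕ} (s : Equiv.Perm (Fin (k + 1)))
    (F : (Fin k → ℝ) → ℝ) :
    ∫ x in modelSimplex k, F (modelMap s x) = ∫ x in modelSimplex k, F x := by
  have hinj : Function.Injective (modelMap s) := by
    refine Function.LeftInverse.injective (g := modelMap s.symm) fun x => ?_
    rw [modelMap_modelMap, Equiv.symm_comp_self, modelMap_id]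
  have h := MeasureTheory.integral_image_eq_integral_abs_det_fderiv_smul MeasureTheory.volume
    (measurableSet_modelSimplex k) (f := modelMap s) (f' := fun _ => modelMapLinear s)
    (fun x _ => ((modelMapLinear s).hasFDerivAt.const_add _).hasFDerivWithinAt) hinj.injOn F
  rw [image_modelMap_perm, det_modelMapLinear] at h
  rw [h]
  refine MeasureTheory.setIntegral_congr_fun (measurableSet_modelSimplex k) fun x _ => ?_
  rcases Int.units_eq_one_or (Equiv.Perm.sign s) with hs | hs <;> simp [hs]

/-- A top-degree alternating form transforms by the determinant. -/
lemma alternating_map_single {k : ℕ} (a : (Fin k → ℝ) [⋀^Fin k]→L[ℝ] ℝ)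
    (L : (Fin k → ℝ) →ₗ[ℝ] (Fin k → ℝ)) :
    (a fun i => L (Pi.single i 1)) = LinearMap.det L * a fun i => Pi.single i 1 := by
  have h := congrArg (fun f => f fun i => L (Pi.single i 1))
    (AlternatingMap.eq_smul_basis_det (Pi.basisFun ℝ (Fin k)) a.toAlternatingMap)
  have h2 := LinearMap.det_toMatrix (Pi.basisFun ℝ (Fin k)) L
  have h3 := (Pi.basisFun ℝ (Fin k)).det_apply fun i => L (Pi.single i 1)
  simp only [AlternatingMap.smul_apply, smul_eq_mul] at h
  rw [h3] at h
  have h4 : (Pi.basisFun ℝ (Fin k)).toMatrix (fun i => L (Pi.single i 1)) =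
      LinearMap.toMatrix (Pi.basisFun ℝ (Fin k)) (Pi.basisFun ℝ (Fin k)) L := by
    ext i j
    simp [Module.Basis.toMatrix_apply]
  rw [h4, h2, mul_comm] at h
  have h5 : ⇑(Pi.basisFun ℝ (Fin k)) = fun i => Pi.single i (1 : ℝ) := by
    funext i
    simp
  rwa [h5] at h

/-! ### Stokes' theorem on the model simplex -/

lemma insertNth_mem_modelSimplex_iff {k : ℕ} (j : Fin (k + 1)) (t : ℝ) (y : Fin k → ℝ) :
    (j.insertNth t y : Fin (k + 1) → ℝ) ∈ modelSimplex (k + 1) ↔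
      y ∈ modelSimplex k ∧ t ∈ Set.Icc 0 (1 - ∑ i, y i) := by
  have hsum : ∑ i, (j.insertNth t y : Fin (k + 1) → ℝ) i = t + ∑ i, y i := by
    rw [Fin.sum_univ_succAbove _ j]
    simp
  simp only [modelSimplex, Set.mem_ofPred_eq, hsum, Set.mem_Icc, Fin.forall_iff_succAbove j,
    Fin.insertNth_apply_same, Fin.insertNth_apply_succAbove]
  constructor
  · rintro ⟨⟨h1, h2⟩, h3⟩
    exact ⟨⟨h2, by linarith⟩, h1, by linarith⟩
  · rintro ⟨⟨h1, h2⟩, h3, h4⟩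
    exact ⟨⟨h3, h1⟩, by linarith⟩

/-- Fubini with the `j`-th coordinate innermost: over `y` it runs from the face `x_j = 0` to the
slanted face `∑ xᵢ = 1`. -/
lemma setIntegral_modelSimplex_succ {k : ℕ} (j : Fin (k + 1)) {F : (Fin (k + 1) → ℝ) → ℝ}
    (hF : ContinuousOn F (modelSimplex (k + 1))) :
    ∫ x in modelSimplex (k + 1), F x =
      ∫ y in modelSimplex k, ∫ t in (0 : ℝ)..(1 - ∑ i, y i), F (j.insertNth t y) := by
  set e : ℝ × (Fin k → ℝ) ≃ᵐ (Fin (k + 1) → ℝ) :=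
    (MeasurableEquiv.piFinSuccAbove (fun _ => ℝ) j).symm with he
  have hmp : MeasureTheory.MeasurePreserving e :=
    (MeasureTheory.volume_preserving_piFinSuccAbove (fun _ : Fin (k + 1) => ℝ) j).symm _
  have hmeas : MeasurableSet (e ⁻¹' modelSimplex (k + 1)) :=
    e.measurable (measurableSet_modelSimplex _)
  have hint : MeasureTheory.IntegrableOn (fun z => F (e z)) (e ⁻¹' modelSimplex (k + 1)) :=
    (hmp.integrableOn_comp_preimage e.measurableEmbedding).2
      (hF.integrableOn_compact (isCompact_modelSimplex _))
  rw [← hmp.setIntegral_preimage_emb e.measurableEmbedding,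
    ← MeasureTheory.integral_indicator hmeas,
    MeasureTheory.Measure.volume_eq_prod, MeasureTheory.integral_prod_symm _
      ((MeasureTheory.integrable_indicator_iff hmeas).2 hint),
    ← MeasureTheory.integral_indicator (measurableSet_modelSimplex k)]
  congr 1
  funext y
  have hez : ∀ t, e (t, y) = j.insertNth t y := fun t => rfl
  by_cases hy : y ∈ modelSimplex k
  · rw [Set.indicator_of_mem hy, intervalIntegral.integral_of_le (by linarith [hy.2]),
      ← MeasureTheory.integral_Icc_eq_integral_Ioc,
      ← MeasureTheory.integral_indicator measurableSet_Icc]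
    congr 1
    funext t
    by_cases ht : t ∈ Set.Icc 0 (1 - ∑ i, y i)
    · rw [Set.indicator_of_mem ht, Set.indicator_of_mem, hez]
      rw [Set.mem_preimage, hez]
      exact (insertNth_mem_modelSimplex_iff j t y).2 ⟨hy, ht⟩
    · rw [Set.indicator_of_notMem ht, Set.indicator_of_notMem]
      rw [Set.mem_preimage, hez]
      exact fun h => ht ((insertNth_mem_modelSimplex_iff j t y).1 h).2
  · rw [Set.indicator_of_notMem hy]
    refine MeasureTheory.integral_eq_zero_of_ae (Filter.Eventually.of_forall fun t => ?_)
    refine Set.indicator_of_notMem ?_ _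
    rw [Set.mem_preimage, hez]
    exact fun h => hy ((insertNth_mem_modelSimplex_iff j t y).1 h).1

lemma hasDerivAt_insertNth {k : ℕ} (j : Fin (k + 1)) (y : Fin k → ℝ) (t : ℝ) :
    HasDerivAt (fun t : ℝ => (j.insertNth t y : Fin (k + 1) → ℝ)) (Pi.single j 1) t := by
  refine hasDerivAt_pi.2 fun i => ?_
  refine Fin.succAboveCases j ?_ (fun i => ?_) i
  · simpa using hasDerivAt_id' t
  · simpa using hasDerivAt_const t (y i)

lemma continuousOn_fderivWithin_modelSimplex {n : ℕ} {E : Type*} [NormedAddCommGroup E]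
    [NormedSpace ℝ E] {b : (Fin n → ℝ) → E} (hb : ContDiffOn ℝ ∞ b (modelSimplex n)) :
    ContinuousOn (fderivWithin ℝ b (modelSimplex n)) (modelSimplex n) :=
  hb.continuousOn_fderivWithin (uniqueDiffOn_modelSimplex n) (by simp)

lemma setIntegral_partialDeriv_modelSimplex {k : ℕ} (j : Fin (k + 1))
    {b : (Fin (k + 1) → ℝ) → ℝ} (hb : ContDiffOn ℝ ∞ b (modelSimplex (k + 1))) :
    ∫ x in modelSimplex (k + 1), fderivWithin ℝ b (modelSimplex (k + 1)) x (Pi.single j 1) =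
      ∫ y in modelSimplex k, (b (j.insertNth (1 - ∑ i, y i) y) - b (j.insertNth 0 y)) := by
  have hc : ContinuousOn
      (fun x => fderivWithin ℝ b (modelSimplex (k + 1)) x (Pi.single j 1))
      (modelSimplex (k + 1)) :=
    (continuousOn_fderivWithin_modelSimplex hb).clm_apply continuousOn_const
  rw [setIntegral_modelSimplex_succ j hc]
  refine MeasureTheory.setIntegral_congr_fun (measurableSet_modelSimplex k) fun y hy => ?_
  have hle : (0 : ℝ) ≤ 1 - ∑ i, y i := by linarith [hy.2]
  have hmaps : Set.MapsTo (fun t : ℝ => (j.insertNth t y : Fin (k + 1) → ℝ))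
      (Set.Icc 0 (1 - ∑ i, y i)) (modelSimplex (k + 1)) :=
    fun t ht => (insertNth_mem_modelSimplex_iff j t y).2 ⟨hy, ht⟩
  have hcont : Continuous fun t : ℝ => (j.insertNth t y : Fin (k + 1) → ℝ) :=
    continuous_iff_continuousAt.2 fun t => (hasDerivAt_insertNth j y t).continuousAt
  refine intervalIntegral.integral_eq_sub_of_hasDerivAt_of_le hle
    (hb.continuousOn.comp hcont.continuousOn hmaps) (fun t ht => ?_) ?_
  · have h1 := (hb.differentiableOn (by simp) _ (hmaps ⟨ht.1.le, ht.2.le⟩)).hasFDerivWithinAt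
    have h2 := h1.comp_hasDerivWithinAt t (hasDerivAt_insertNth j y t).hasDerivWithinAt hmaps
    exact h2.hasDerivAt (Icc_mem_nhds ht.1 ht.2)
  · refine ContinuousOn.intervalIntegrable ?_
    rw [Set.uIcc_of_le hle]
    exact hc.comp hcont.continuousOn hmaps

/-- Evaluating an alternating map on the edges of a simplex out of its zeroth vertex. -/
lemma alternating_sub_zero {E : Type*} [NormedAddCommGroup E] [NormedSpace ℝ E] {k : ℕ}
    (a : E [⋀^Fin k]→L[ℝ] ℝ) (v : Fin (k + 1) → E) (l : E →L[ℝ] ℝ) (hl : ∀ i, l (v i) = 1) :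
    (a fun i => v i.succ - v 0) = ∑ j : Fin (k + 1), (-1 : ℝ) ^ (j : ℕ) * a (j.removeNth v) := by
  -- The alternatization of `l ⊗ a` does not change when `v 0` is subtracted from the other entries
  -- one at a time. On the original tuple `l` is always `1`, which gives the alternating sum; after
  -- all subtractions `l` vanishes on every entry but the zeroth, which leaves the left-hand side.
  have key : ∀ s : Finset (Fin k), ContinuousAlternatingMap.alternatizeUncurryFin (l.smulRight a)
      (Fin.cons (v 0) fun i => if i ∈ s then v i.succ - v 0 else v i.succ) =
      ContinuousAlternatingMap.alternatizeUncurryFin (l.smulRight a) v := by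
    intro s
    induction s using Finset.induction_on with
    | empty =>
      congr 1
      funext i
      refine Fin.cases ?_ (fun i => ?_) i <;> simp
    | insert i s hi ih =>
      rw [← ih]
      set w : Fin (k + 1) → E :=
        Fin.cons (v 0) fun i => if i ∈ s then v i.succ - v 0 else v i.succ with hw
      have h : (Fin.cons (v 0) fun j => if j ∈ insert i s then v j.succ - v 0 else v j.succ :
          Fin (k + 1) → E) = Function.update w i.succ (w i.succ - w 0) := by
        funext j
        refine Fin.cases ?_ (fun j => ?_) j
        · rw [Function.update_of_ne (Fin.succ_ne_zero i).symm]
          simp [hw]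
        · by_cases hj : j = i
          · subst hj
            simp [hw, hi]
          · rw [Function.update_of_ne (by simpa using hj)]
            simp [hw, hj]
      rw [h, ContinuousAlternatingMap.map_update_sub, Function.update_eq_self,
        ContinuousAlternatingMap.map_eq_zero_of_eq _ (Function.update w i.succ (w 0))
          (i := i.succ) (j := 0) _ (Fin.succ_ne_zero i), sub_zero]
      rw [Function.update_self, Function.update_of_ne (Fin.succ_ne_zero i).symm]
  have h := key Finset.univ
  rw [ContinuousAlternatingMap.alternatizeUncurryFin_apply,
    ContinuousAlternatingMap.alternatizeUncurryFin_apply, Fin.sum_univ_succ] at h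
  simp only [Finset.mem_univ, if_true, Fin.cons_zero, Fin.cons_succ,
    ContinuousLinearMap.smulRight_apply, hl, map_sub, sub_self, smul_zero,
    Finset.sum_const_zero, add_zero, one_smul, ContinuousAlternatingMap.coe_zero, Pi.zero_apply,
    Fin.val_zero, pow_zero, Fin.removeNth_zero, Fin.tail_cons] at h
  rw [h]
  simp [zsmul_eq_mul]

lemma modelMap_succAbove_succ {k : ℕ} (j : Fin (k + 1)) (y : Fin k → ℝ) :
    modelMap j.succ.succAbove y = j.insertNth 0 y := by
  rw [modelMap, modelMapLinear_apply]
  ext i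
  refine Fin.succAboveCases j ?_ (fun i => ?_) i <;>
    simp [modelVertex_zero, modelVertex_succ, Pi.single_apply]

lemma modelMapLinear_succAbove_succ {k : ℕ} (j : Fin (k + 1)) (i : Fin k) :
    modelMapLinear j.succ.succAbove (Pi.single i 1) = Pi.single (j.succAbove i) 1 := by
  rw [modelMapLinear_single]
  simp [modelVertex_zero, modelVertex_succ]

/-- This ordering of the slanted face begins with the `j`-th basis vector and keeps the others in
order, so the face becomes the graph of `x_j = 1 - ∑ yᵢ`, which is the upper endpoint in the Fubini
formula. -/
lemma modelMap_succ_cycleRange_symm {k : ℕ} (j : Fin (k + 1)) (y : Fin k → ℝ) :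
    modelMap (Fin.succ ∘ j.cycleRange.symm) y = j.insertNth (1 - ∑ i, y i) y := by
  rw [modelMap, modelMapLinear_apply]
  ext i
  refine Fin.succAboveCases j ?_ (fun i => ?_) i <;>
    simp [modelVertex_succ, Pi.single_apply, sub_eq_add_neg]

theorem stokes_modelSimplex {k : ℕ}
    {β : (Fin (k + 1) → ℝ) → (Fin (k + 1) → ℝ) [⋀^Fin k]→L[ℝ] ℝ}
    (hβ : ContDiffOn ℝ ∞ β (modelSimplex (k + 1))) :
    ∫ x in modelSimplex (k + 1),
        extDerivWithin β (modelSimplex (k + 1)) x (fun i => Pi.single i 1) =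
      ∑ i : Fin (k + 2), (-1 : ℝ) ^ (i : ℕ) * ∫ y in modelSimplex k,
        β (modelMap i.succAbove y) fun l => modelMapLinear i.succAbove (Pi.single l 1) := by
  set S := modelSimplex (k + 1) with hS
  -- `b j` is the coefficient of the form `dx` with `dx_j` omitted, so `dβ` has top coefficient `∑
  -- (-1)ʲ ∂_j b_j`.
  let b (j : Fin (k + 1)) (x : Fin (k + 1) → ℝ) : ℝ := β x fun l => Pi.single (j.succAbove l) 1
  have hev (v : Fin k → Fin (k + 1) → ℝ) : ContDiffOn ℝ ∞ (fun x => β x v) S :=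
    (ContinuousAlternatingMap.apply ℝ (Fin (k + 1) → ℝ) ℝ v).contDiff.comp_contDiffOn hβ
  have hb (j : Fin (k + 1)) : ContDiffOn ℝ ∞ (b j) S := hev _
  have hd : ∀ x ∈ S, extDerivWithin β S x (fun i => Pi.single i 1) =
      ∑ j : Fin (k + 1), (-1 : ℝ) ^ (j : ℕ) * fderivWithin ℝ (b j) S x (Pi.single j 1) := by
    intro x hx
    rw [extDerivWithin_apply (hβ.differentiableOn (by simp) x hx)
      (uniqueDiffOn_modelSimplex _ x hx)]
    refine Finset.sum_congr rfl fun j _ => ?_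
    simp only [zsmul_eq_mul, Int.cast_pow, Int.cast_neg, Int.cast_one, b]
    rfl
  have hint (j : Fin (k + 1)) : MeasureTheory.IntegrableOn
      (fun x => fderivWithin ℝ (b j) S x (Pi.single j 1)) S :=
    ((continuousOn_fderivWithin_modelSimplex (hb j)).clm_apply
      continuousOn_const).integrableOn_compact (isCompact_modelSimplex _)
  have hbint (j : Fin (k + 1)) (f : Fin (k + 1) → Fin (k + 2)) : MeasureTheory.IntegrableOn
      (fun y => b j (modelMap f y)) (modelSimplex k) :=
    ((hb j).continuousOn.comp (continuous_modelMap f).continuousOn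
      fun y hy => modelMap_mem f hy).integrableOn_compact (isCompact_modelSimplex _)
  -- The slanted face is opposite to vertex `0`. Integrating each `∂_j b_j` yields it in a different
  -- parametrization; these are all replaced by `Fin.succ`, and the coefficients then combine
  -- through `alternating_sub_zero`, with `l` the sum of the coordinates.
  have hzero : ∫ y in modelSimplex k, (β (modelMap (Fin.succAbove 0) y) fun l =>
      modelMapLinear (Fin.succAbove 0) (Pi.single l 1)) =
      ∑ j : Fin (k + 1), (-1 : ℝ) ^ (j : ℕ) * ∫ y in modelSimplex k,
        b j (modelMap (Fin.succ ∘ j.cycleRange.symm) y) := by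
    have h1 (j : Fin (k + 1)) : ∫ y in modelSimplex k,
        b j (modelMap (Fin.succ ∘ j.cycleRange.symm) y) =
        ∫ y in modelSimplex k, b j (modelMap Fin.succ y) := by
      rw [← setIntegral_comp_modelMap_perm j.cycleRange.symm fun y => b j (modelMap Fin.succ y)]
      simp only [modelMap_modelMap]
    simp only [h1, ← MeasureTheory.integral_const_mul]
    rw [← MeasureTheory.integral_finsetSum _ fun j _ => (hbint j _).const_mul _]
    refine MeasureTheory.setIntegral_congr_fun (measurableSet_modelSimplex k) fun y _ => ?_
    simp only [Fin.succAbove_zero, modelMapLinear_single, modelVertex_succ]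
    have := alternating_sub_zero (β (modelMap Fin.succ y)) (fun i => modelVertex (k + 1) i.succ)
      (∑ i, ContinuousLinearMap.proj i) (fun i => by
        simp [modelVertex_succ])
    exact this
  rw [MeasureTheory.setIntegral_congr_fun (measurableSet_modelSimplex _) hd,
    MeasureTheory.integral_finsetSum _ fun j _ => (hint j).const_mul _,
    Fin.sum_univ_succ (n := k + 1), hzero]
  simp only [MeasureTheory.integral_const_mul, Fin.val_zero, pow_zero, one_mul,
    ← Finset.sum_add_distrib]
  -- For each `j`, the upper endpoint contributes to face `0`. The lower one is face `j + 1`, and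
  -- its minus sign turns `(-1)ʲ` into `(-1)ʲ⁺¹`.
  refine Finset.sum_congr rfl fun j _ => ?_
  rw [hS, setIntegral_partialDeriv_modelSimplex j (hb j)]
  simp only [← modelMap_succ_cycleRange_symm, ← modelMap_succAbove_succ]
  rw [MeasureTheory.integral_sub (hbint j _) (hbint j _)]
  simp only [modelMapLinear_succAbove_succ, Fin.val_succ, b]
  ring

/-! ### Averaging over path classes -/

/-- Composition with a map, on bounded functions. -/
def boundedComp {A B : Type*} (φ : A → B) : boundedFunctions B →ₗ[ℝ] boundedFunctions A where
  toFun f := ⟨fun a => f.1 (φ a), f.2.imp fun _ h a => h (φ a)⟩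
  map_add' _ _ := rfl
  map_smul' _ _ := rfl

/-- On an amenable path-connected space, bounded functions of path classes out of the base point
can be averaged compatibly with prolonging the paths. -/
lemma exists_pathMean {X : Type*} [TopologicalSpace X] [PathConnectedSpace X] (x₀ : X)
    (hG : IsAmenable (FundamentalGroup X x₀)) :
    ∃ M : ∀ y : X, boundedFunctions (Path.Homotopic.Quotient x₀ y) →ₗ[ℝ] ℝ,
      (∀ y, M y (boundedOne _) = 1) ∧
      ∀ (y z : X) (q : Path.Homotopic.Quotient y z)
        (f : boundedFunctions (Path.Homotopic.Quotient x₀ z)),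
        M y (boundedComp (fun p => p.trans q) f) = M z f := by
  obtain ⟨m, hone, -, hinv⟩ := hG
  -- Prefixing loops to a fixed `p` parametrizes the path classes ending at `y` by the fundamental
  -- group.
  let T (y : X) (p : Path.Homotopic.Quotient x₀ y) (γ : FundamentalGroup X x₀) :
      Path.Homotopic.Quotient x₀ y := Path.Homotopic.Quotient.trans γ p
  -- The product `d * γ` is `γ` followed by `d`. Replacing `p'` by `p` inserts the loop `d = p ·
  -- p'⁻¹` after `γ`, which is a left translation, so the mean does not depend on the choice of `p`.
  have hT (y : X) (p p' : Path.Homotopic.Quotient x₀ y)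
      (f : boundedFunctions (Path.Homotopic.Quotient x₀ y)) :
      m (boundedComp (T y p) f) = m (boundedComp (T y p') f) := by
    let d : FundamentalGroup X x₀ := p.trans p'.symm
    rw [← hinv d⁻¹ (boundedComp (T y p') f)]
    congr 1
    ext γ
    refine congrArg f.1 (?_ : T y p γ = T y p' (d⁻¹⁻¹ * γ))
    rw [inv_inv]
    change Path.Homotopic.Quotient.trans γ p =
      (Path.Homotopic.Quotient.trans γ (p.trans p'.symm)).trans p'
    simp [Path.Homotopic.Quotient.trans_assoc]
  let P (y : X) : Path.Homotopic.Quotient x₀ y :=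
    Path.Homotopic.Quotient.mk (PathConnectedSpace.somePath x₀ y)
  refine ⟨fun y => m ∘ₗ boundedComp (T y (P y)), fun y => hone, fun y z q f => ?_⟩
  rw [LinearMap.comp_apply, LinearMap.comp_apply, hT z (P z) ((P y).trans q)]
  congr 1
  ext γ
  exact congrArg f.1 (Path.Homotopic.Quotient.trans_assoc _ _ _)

namespace AbstractSimplicialComplex

/-! ### Lifting simplices to the universal cover -/

/-- Two paths with the same ends that run inside one simplex are homotopic. -/
lemma homotopic_of_support_subset {V : Type*} [Fintype V]
    {K : AbstractSimplicialComplex V} {x y : K.Realization} (p q : Path x y)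
    {s : Finset V} (hs : s ∈ K.faces) (hp : ∀ t, ∀ v ∉ s, (p t).1 v = 0)
    (hq : ∀ t, ∀ v ∉ s, (q t).1 v = 0) :
    p.Homotopic q := by
  refine ⟨{ toFun := fun z => ⟨fun v => (1 - (z.1 : ℝ)) * (p z.2).1 v + (z.1 : ℝ) * (q z.2).1 v,
      fun v => add_nonneg (mul_nonneg (sub_nonneg.2 z.1.2.2) ((p z.2).2.1 v))
        (mul_nonneg z.1.2.1 ((q z.2).2.1 v)), ?_, s, hs, fun v hv => ?_⟩
            continuous_toFun := ?_
            map_zero_left := fun t => ?_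
            map_one_left := fun t => ?_
            prop' := fun t z hz => ?_ }⟩
  · rw [Finset.sum_add_distrib, ← Finset.mul_sum, ← Finset.mul_sum, (p z.2).2.2.1, (q z.2).2.2.1]
    ring
  · simp [hp z.2 v hv, hq z.2 v hv]
  · refine Continuous.subtype_mk (continuous_pi fun v => ?_) _
    have hp' : Continuous fun z : unitInterval × unitInterval => (p z.2).1 v :=
      (continuous_apply v).comp (continuous_subtype_val.comp (p.continuous.comp continuous_snd))
    have hq' : Continuous fun z : unitInterval × unitInterval => (q z.2).1 v :=
      (continuous_apply v).comp (continuous_subtype_val.comp (q.continuous.comp continuous_snd))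
    have ht : Continuous fun z : unitInterval × unitInterval => (z.1 : ℝ) :=
      continuous_subtype_val.comp continuous_fst
    exact ((continuous_const.sub ht).mul hp').add (ht.mul hq')
  · ext v
    simp
  · ext v
    simp
  · ext v
    rcases hz with rfl | hz
    · simp
      ring
    · obtain rfl := Set.mem_singleton_iff.1 hz
      simp
      ring

lemma OrderedSimplex.ext_vert {V : Type*} {K : AbstractSimplicialComplex V} {n : ℕ}
    {e e' : K.OrderedSimplex n} (h : ∀ i, e.vert i = e'.vert i) : e = e' := by
  obtain ⟨v, hv⟩ := e
  obtain ⟨w, hw⟩ := e'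
  obtain rfl : v = w := DFunLike.ext _ _ h
  rfl

lemma OrderedSimplex.edge_mem {V : Type*} [DecidableEq V] {K : AbstractSimplicialComplex V} {n : ℕ}
    (e : K.OrderedSimplex n) (i j : Fin (n + 1)) :
    {e.vert i, e.vert j} ∈ K.faces := by
  refine (K.isRelLowerSet_faces e.mem).2 (fun v hv => ?_) (by simp)
  rcases Finset.mem_insert.1 hv with rfl | hv
  · simp
  · obtain rfl := Finset.mem_singleton.1 hv
    simp

variable {V : Type*} [Fintype V] [DecidableEq V] {K : AbstractSimplicialComplex V}

lemma edgePath_support {v w : V} (h : {v, w} ∈ K.faces) (t : unitInterval) {u : V}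
    (hv : u ≠ v) (hw : u ≠ w) : (K.edgePath h t).1 u = 0 := by
  change (1 - (t : ℝ)) * (K.vertexPoint v).1 u + (t : ℝ) * (K.vertexPoint w).1 u = 0
  simp [vertexPoint, hv, hw]

/-- Both sides run inside the single simplex `s`, where the straight-line homotopy is available.
This is what makes the lifted vertices span a simplex of the cover. -/
lemma mk_edgePath_trans {a b c : V} (hab : {a, b} ∈ K.faces) (hbc : {b, c} ∈ K.faces)
    (hac : {a, c} ∈ K.faces) {s : Finset V} (hs : s ∈ K.faces) (ha : a ∈ s) (hb : b ∈ s)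
    (hc : c ∈ s) :
    (Path.Homotopic.Quotient.mk (K.edgePath hab)).trans
      (Path.Homotopic.Quotient.mk (K.edgePath hbc)) =
      Path.Homotopic.Quotient.mk (K.edgePath hac) := by
  rw [← Path.Homotopic.Quotient.mk_trans, Path.Homotopic.Quotient.eq]
  have hne : ∀ {v w : V}, v ∉ s → w ∈ s → v ≠ w := fun hv hw h => hv (h ▸ hw)
  refine homotopic_of_support_subset _ _ hs (fun t v hv => ?_) fun t v hv =>
    edgePath_support hac t (hne hv ha) (hne hv hc)
  have ht : ((K.edgePath hab).trans (K.edgePath hbc)) t ∈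
      Set.range (K.edgePath hab) ∪ Set.range (K.edgePath hbc) := by
    rw [← Path.trans_range]
    exact ⟨t, rfl⟩
  rcases ht with ⟨r, hr⟩ | ⟨r, hr⟩
  · rw [← hr]
    exact edgePath_support hab r (hne hv ha) (hne hv hb)
  · rw [← hr]
    exact edgePath_support hbc r (hne hv hb) (hne hv hc)

namespace OrderedSimplex

/-- The class of the edge from the `i`-th to the `j`-th vertex of a simplex. -/
def edgeClass {n : ℕ} (e : K.OrderedSimplex n) (i j : Fin (n + 1)) :
    Path.Homotopic.Quotient (K.vertexPoint (e.vert i)) (K.vertexPoint (e.vert j)) :=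
  Path.Homotopic.Quotient.mk (K.edgePath (e.edge_mem i j))

lemma edgeClass_trans {n : ℕ} (e : K.OrderedSimplex n) (i j l : Fin (n + 1)) :
    (e.edgeClass i j).trans (e.edgeClass j l) = e.edgeClass i l :=
  mk_edgePath_trans _ _ _ e.mem (by simp) (by simp) (by simp)

/-- The lift of a simplex whose zeroth vertex is given by a path class. -/
def lift {x₀ : K.Realization} {n : ℕ} (e : K.OrderedSimplex n)
    (p : Path.Homotopic.Quotient x₀ (K.vertexPoint (e.vert 0))) :
    (K.universalCover x₀).OrderedSimplex n where
  vert := ⟨fun i => ⟨e.vert i, p.trans (e.edgeClass 0 i)⟩, fun i j h =>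
    e.vert.injective (congrArg CoverVertex.base h)⟩
  mem := by
    refine ⟨?_, ?_, ?_⟩
    · intro a ha b hb hab
      simp only [Finset.coe_map, Finset.coe_univ, Set.image_univ, Set.mem_range] at ha hb
      obtain ⟨i, rfl⟩ := ha
      obtain ⟨j, rfl⟩ := hb
      rw [e.vert.injective hab]
    · convert e.mem using 1
      ext v
      simp only [Finset.mem_image, Finset.mem_map, Finset.mem_univ, true_and,
        exists_exists_eq_and]
      rfl
    · intro a ha b hb
      simp only [Finset.mem_map, Finset.mem_univ, true_and] at ha hb
      obtain ⟨i, rfl⟩ := ha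
      obtain ⟨j, rfl⟩ := hb
      refine ⟨e.edge_mem i j, ?_⟩
      change p.trans (e.edgeClass 0 j) = (p.trans (e.edgeClass 0 i)).trans (e.edgeClass i j)
      rw [Path.Homotopic.Quotient.trans_assoc, edgeClass_trans]

lemma lift_proj {x₀ : K.Realization} {n : ℕ} (e : K.OrderedSimplex n)
    (p : Path.Homotopic.Quotient x₀ (K.vertexPoint (e.vert 0))) : (e.lift p).proj = e := rfl

/-- A face may have a different zeroth vertex, so its path class is prolonged along the edge to `f
0`; the means of `exists_pathMean` are compatible with exactly this operation. -/
lemma lift_face {x₀ : K.Realization} {m n : ℕ} (e : K.OrderedSimplex n)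
    (p : Path.Homotopic.Quotient x₀ (K.vertexPoint (e.vert 0)))
    (f : Fin (m + 1) ↪ Fin (n + 1)) :
    (e.lift p).face f = (e.face f).lift (p.trans (e.edgeClass 0 (f 0))) := by
  refine ext_vert fun i => ?_
  change (⟨e.vert (f i), p.trans (e.edgeClass 0 (f i))⟩ : K.CoverVertex x₀) =
    ⟨e.vert (f i), (p.trans (e.edgeClass 0 (f 0))).trans (e.edgeClass (f 0) (f i))⟩
  rw [Path.Homotopic.Quotient.trans_assoc, edgeClass_trans]

end OrderedSimplex

/-- A bounded cochain on the universal cover whose coboundary is pulled back from the base can be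
averaged to a cochain on the base. -/
lemma mem_coboundaries_of_bounded_primitive [PathConnectedSpace K.Realization]
    (x₀ : K.Realization) (hG : IsAmenable (FundamentalGroup K.Realization x₀)) {k : ℕ}
    {b : (K.universalCover x₀).OrderedSimplex k → ℝ} (hb : b ∈ (K.universalCover x₀).cochains k)
    (hbdd : ∃ C : ℝ, ∀ e, |b e| ≤ C) {a : K.OrderedSimplex (k + 1) → ℝ}
    (ha : ∀ e, (K.universalCover x₀).coboundary k b e = a e.proj) :
    a ∈ K.coboundaries (k + 1) := by
  obtain ⟨M, hone, hM⟩ := exists_pathMean x₀ hG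
  let B {n : ℕ} (e : K.OrderedSimplex n) (f : Fin (k + 1) ↪ Fin (n + 1)) :
      boundedFunctions (Path.Homotopic.Quotient x₀ (K.vertexPoint (e.vert 0))) :=
    ⟨fun p => b ((e.lift p).face f), hbdd.imp fun _ h p => h _⟩
  let c (e : K.OrderedSimplex k) : ℝ := M _ (B e (Function.Embedding.refl _))
  -- The average over the lifts of a face equals the average over the lifts of the whole simplex.
  -- All faces of `e` are thereby averaged by one linear functional.
  have hc {n : ℕ} (e : K.OrderedSimplex n) (f : Fin (k + 1) ↪ Fin (n + 1)) :
      c (e.face f) = M _ (B e f) := by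
    have h := hM _ _ (e.edgeClass 0 (f 0)) (B (e.face f) (Function.Embedding.refl _))
    refine h.symm.trans (congrArg (M _) (Subtype.ext (funext fun p => ?_)))
    change b _ = b _
    rw [OrderedSimplex.lift_face]
    rfl
  refine ⟨c, fun e s => ?_, funext fun e => ?_⟩
  · rw [hc, ← smul_eq_mul, ← map_smul]
    refine congrArg (M _) (Subtype.ext (funext fun p => ?_))
    exact hb (e.lift p) s
  · have h : ∑ i : Fin (k + 2), (-1 : ℝ) ^ (i : ℕ) • B e (Fin.succAboveEmb i) =
        a e • boundedOne _ := by
      refine Subtype.ext (funext fun p => ?_)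
      have := ha (e.lift p)
      rw [OrderedSimplex.lift_proj] at this
      simp only [Submodule.coe_sum, Finset.sum_apply, Submodule.coe_smul, Pi.smul_apply,
        smul_eq_mul]
      refine this.trans ?_
      simp [boundedOne]
    have h' := congrArg (M _) h
    rw [map_sum, map_smul, hone, smul_eq_mul, mul_one] at h'
    rw [← h']
    change ∑ i : Fin (k + 2), (-1 : ℝ) ^ (i : ℕ) * c (e.face (Fin.succAboveEmb i)) = _
    refine Finset.sum_congr rfl fun i _ => ?_
    rw [hc, map_smul, smul_eq_mul]

end AbstractSimplicialComplex

/-! ### Integration of forms over simplices -/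

open scoped MatrixOrder Matrix.Norms.L2Operator in
/-- The value of a top-degree form on a basis is controlled by its values on orthonormal bases and
by the Gram determinant. -/
lemma abs_alternating_single_le {k : ℕ} (a : (Fin k → ℝ) [⋀^Fin k]→L[ℝ] ℝ)
    (B : (Fin k → ℝ) →L[ℝ] (Fin k → ℝ) →L[ℝ] ℝ) (hsymm : ∀ v w, B v w = B w v)
    (hpos : ∀ v, v ≠ 0 → 0 < B v v) {C : ℝ}
    (hC : ∀ v : Fin k → Fin k → ℝ, (∀ i j, B (v i) (v j) = if i = j then 1 else 0) →
      |a v| ≤ C) :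
    |a fun i => Pi.single i 1| ≤
      √(Matrix.of fun i j : Fin k => B (Pi.single i 1) (Pi.single j 1)).det * C := by
  set G : Matrix (Fin k) (Fin k) ℝ :=
    Matrix.of fun i j : Fin k => B (Pi.single i 1) (Pi.single j 1) with hG
  have hB (v w : Fin k → ℝ) : B v w = v ⬝ᵥ G.mulVec w := by
    conv_lhs => rw [pi_eq_sum_univ' v, pi_eq_sum_univ' w]
    simp only [map_sum, map_smul, sum_apply, smul_apply, smul_eq_mul,
      dotProduct, Matrix.mulVec, Finset.mul_sum, hG, Matrix.of_apply]
    rw [Finset.sum_comm]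
    refine Finset.sum_congr rfl fun i _ => Finset.sum_congr rfl fun j _ => ?_
    ring
  have hpd : G.PosDef := by
    refine Matrix.PosDef.of_dotProduct_mulVec_pos ?_ fun v hv => ?_
    · ext i j
      simp [hG, hsymm (Pi.single j 1)]
    · simpa [hB] using hpos v hv
  -- Write the Gram matrix as `G = AᵀA`. The columns of `A⁻¹` are orthonormal, `a` takes on them
  -- `(det A)⁻¹` times its value on the standard basis, and `|det A| = √(det G)`.
  obtain ⟨A, hA⟩ := CStarAlgebra.nonneg_iff_eq_star_mul_self.mp hpd.posSemidef.nonneg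
  rw [Matrix.star_eq_conjTranspose, Matrix.conjTranspose_eq_transpose_of_trivial] at hA
  have hdet : G.det = A.det ^ 2 := by
    rw [hA, Matrix.det_mul, Matrix.det_transpose, sq]
  have hA0 : A.det ≠ 0 := fun h => hpd.det_pos.ne' (by rw [hdet, h]; simp)
  have hv := hC (fun i => A⁻¹.mulVec (Pi.single i 1)) fun i j => by
    have hinv : A * A⁻¹ = 1 := Matrix.mul_nonsing_inv _ (Ne.isUnit hA0)
    rw [hB, hA, ← Matrix.mulVec_mulVec, Matrix.dotProduct_mulVec, Matrix.vecMul_transpose,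
      Matrix.mulVec_mulVec, Matrix.mulVec_mulVec, hinv, Matrix.one_mulVec, Matrix.one_mulVec]
    simp [Pi.single_apply, eq_comm]
  have h2 := alternating_map_single a (Matrix.toLin' A⁻¹)
  simp only [Matrix.toLin'_apply, LinearMap.det_toLin', Matrix.det_nonsing_inv,
    Ring.inverse_eq_inv'] at h2
  rw [h2, abs_mul, abs_inv, inv_mul_le_iff₀ (abs_pos.2 hA0)] at hv
  rwa [hdet, Real.sqrt_sq_eq_abs]

namespace AbstractSimplicialComplex

/-- Reordering pulls the form back along an affine map of determinant `sign s`: the integrand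
acquires that sign, while the unoriented integral is invariant. -/
lemma DiffForm.integral_mem_cochains {V : Type*} {K : AbstractSimplicialComplex V} {k : ℕ}
    (β : K.DiffForm k) : β.integral ∈ K.cochains k := by
  intro e s
  simp only [DiffForm.integral]
  rw [← setIntegral_comp_modelMap_perm s fun x => β.form e x fun i => Pi.single i 1,
    ← MeasureTheory.integral_const_mul]
  refine MeasureTheory.setIntegral_congr_fun (measurableSet_modelSimplex k) fun x hx => ?_
  have h := alternating_map_single (β.form e (modelMap s x)) (modelMapLinear s).toLinearMap
  simp only [β.compatible e s.toEmbedding x hx]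
  rw [← det_modelMapLinear]
  exact h

/-- Stokes' theorem for forms on a simplicial complex. -/
lemma DiffForm.coboundary_integral {V : Type*} {K : AbstractSimplicialComplex V} {k : ℕ}
    {β : K.DiffForm k} {η : K.DiffForm (k + 1)} (h : β.IsPrimitive η) :
    K.coboundary k β.integral = η.integral := by
  funext e
  have hs := stokes_modelSimplex (β.smooth e)
  have hη : η.integral e = ∫ x in modelSimplex (k + 1),
      extDerivWithin (β.form e) (modelSimplex (k + 1)) x (fun i => Pi.single i 1) :=
    MeasureTheory.setIntegral_congr_fun (measurableSet_modelSimplex _) fun x hx => by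
      rw [h e x hx]
  rw [hη, hs]
  change ∑ i : Fin (k + 2), (-1 : ℝ) ^ (i : ℕ) * β.integral (e.face (Fin.succAboveEmb i)) = _
  refine Finset.sum_congr rfl fun i _ => ?_
  congr 1
  refine MeasureTheory.setIntegral_congr_fun (measurableSet_modelSimplex k) fun x hx => ?_
  simp only [β.compatible e (Fin.succAboveEmb i) x hx]
  rfl

lemma OrderedSimplex.finite {V : Type*} [Finite V] (K : AbstractSimplicialComplex V) (n : ℕ) :
    Finite (K.OrderedSimplex n) :=
  Finite.of_injective (fun e : K.OrderedSimplex n => e.vert) fun _ _ h =>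
    OrderedSimplex.ext_vert fun i => DFunLike.congr_fun h i

lemma Metric.continuousOn_gram {V : Type*} {K : AbstractSimplicialComplex V} (g : K.Metric)
    {n : ℕ} (e : K.OrderedSimplex n) :
    ContinuousOn (fun x => √(Matrix.of fun i j : Fin n =>
      g.inner e x (Pi.single i 1) (Pi.single j 1)).det) (modelSimplex n) := by
  refine Real.continuous_sqrt.comp_continuousOn ?_
  refine (Continuous.matrix_det continuous_id).comp_continuousOn ?_
  refine continuousOn_pi.2 fun i => continuousOn_pi.2 fun j => ?_
  exact ((g.smooth e).continuousOn.clm_apply continuousOn_const).clm_apply continuousOn_const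

lemma DiffForm.IsBounded.integral_bounded {V : Type*} [Fintype V] [DecidableEq V]
    {K : AbstractSimplicialComplex V} {x₀ : K.Realization} {g : K.Metric} {k : ℕ}
    {β : (K.universalCover x₀).DiffForm k} (hβ : β.IsBounded (g.pullback x₀)) :
    ∃ C : ℝ, ∀ e, |β.integral e| ≤ C := by
  obtain ⟨C, hC⟩ := hβ
  have hD (e : K.OrderedSimplex k) : ∃ D : ℝ, ∀ x ∈ modelSimplex k,
      |√(Matrix.of fun i j : Fin k =>
        g.inner e x (Pi.single i 1) (Pi.single j 1)).det| ≤ D :=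
    (isCompact_modelSimplex k).exists_bound_of_continuousOn (g.continuousOn_gram e)
  choose D hD using hD
  have := OrderedSimplex.finite K k
  obtain ⟨D', hD'⟩ := (Set.finite_range D).bddAbove
  -- `D'` bounds the Riemannian volume density `√(det G)` on all the finitely many `k`-simplices of
  -- `K` at once. `|C|` replaces `C` so that multiplying by it preserves inequalities.
  refine ⟨D' * |C| * MeasureTheory.volume.real (modelSimplex k), fun e => ?_⟩
  rw [← Real.norm_eq_abs, DiffForm.integral]
  refine MeasureTheory.norm_setIntegral_le_of_norm_le_const
    (isCompact_modelSimplex k).measure_lt_top fun x hx => ?_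
  have h1 := abs_alternating_single_le (β.form e x) (g.inner e.proj x) (g.symm e.proj x hx)
    (g.pos e.proj x hx) (C := |C|) fun v hv => (hC e x hx v hv).trans (le_abs_self C)
  refine h1.trans (mul_le_mul_of_nonneg_right ?_ (abs_nonneg C))
  exact ((le_abs_self _).trans (hD e.proj x hx)).trans (hD' ⟨_, rfl⟩)

end AbstractSimplicialComplex

end

/-! ### Vanishing of hyperbolic classes -/

theorem theorem5p3 {V : Type*} [Fintype V] [DecidableEq V] (K : AbstractSimplicialComplex V)
    [PathConnectedSpace K.Realization] (x₀ : K.Realization)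
    (hG : IsAmenable (FundamentalGroup K.Realization x₀))
    (g : K.Metric) (k : ℕ) (α : K.Cohomology k)
    (hα : AbstractSimplicialComplex.IsHyperbolic x₀ g α) : α = 0 := by
  obtain ⟨η, ⟨-, a, ha, rfl⟩, hη⟩ := hα
  rw [AbstractSimplicialComplex.cohomologyClass, Submodule.Quotient.mk_eq_zero]
  change a.1 ∈ K.coboundaries k
  rw [ha]
  cases k with
  | zero =>
    -- There are no nonzero coboundaries in degree `0`, so the cocycle itself must vanish. A path
    -- from `x₀` lifts each vertex to the cover, where the pulled-back form is zero.
    refine (Submodule.mem_bot ℝ).2 (funext fun e => ?_)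
    refine (MeasureTheory.setIntegral_congr_fun (measurableSet_modelSimplex 0)
      fun x hx => ?_).trans (MeasureTheory.integral_zero _ _)
    have h := hη (e.lift (Path.Homotopic.Quotient.mk (PathConnectedSpace.somePath x₀ _))) x hx
    change η.form e x = 0 at h
    simp [h]
  | succ k =>
    obtain ⟨β, hβ, hbdd⟩ := hη
    -- The integral of the pulled-back form over `e` is by definition that of `η` over `e.proj`, so
    -- Stokes' theorem gives the required equation directly.
    exact AbstractSimplicialComplex.mem_coboundaries_of_bounded_primitive x₀ hG
      β.integral_mem_cochains hbdd.integral_bounded fun e =>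
        congrFun (AbstractSimplicialComplex.DiffForm.coboundary_integral hβ) e
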